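/- Trees are finite, rooted and plane (the children of each vertex are linearly ordered from left to right), considered up to isomorphism of plane rooted trees; regard a tree as a poset whose maximal element is the root. For $n\ge 0$ let $\mathcal{B}_n$ be the family of all plane binary trees with $n$ vertices, i.e. plane trees with $n$ vertices in which every vertex has either $0$ or $2$ children. An embedding of a plane tree $S$ into a plane tree $T$ is a subset of the vertices of $T$ which, with the order inherited from $T$, is isomorphic to $S$ by an isomorphism respecting the left-to-right order of the children of each vertex of $S$; it is good if it contains the root of $T$. Let $a_{\mathcal{B}_n}(S)$ and $g_{\mathcal{B}_n}(S)$ be the total numbers of embeddings and of good embeddings of $S$ into the trees $T\in\mathcal{B}_n$, summed over all $T\in\mathcal{B}_n$. Theorem. Let $S$ be a plane rooted tree with $m$ vertices, $l$ leaves, and $d_i$ vertices with exactly $i$ children ($0\le i\le m-1$, so $l=d_0$). Let $\boldsymbol{C}_k=\frac1{k+1}\binom{2k}{k}$ be the Catalan numbers and $C=\prod_{i=3}^{m-1}(\boldsymbol{C}_{i-1})^{d_i}$. Then, as $n\to\infty$ through the odd integers, $$a_{\mathcal{B}_n}(S)\sim\frac{C\cdot 2^{\frac{5-m-3l}{2}}}{\Gamma\left(\frac{m+l-1}{2}\right)}\cdot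 2^n\cdot n^{\frac{m+l-3}{2}},$$ $$g_{\mathcal{B}_n}(S)\sim\begin{cases}\dfrac{C\cdot 2^{\frac{6-m-3l}{2}}}{\Gamma\left(\frac{m+l-2}{2}\right)}\cdot 2^n\cdot n^{\frac{m+l-4}{2}} & \text{if } m+l-2>0,\\[2ex] \dfrac{\sqrt2\cdot 2^n}{\sqrt{\pi n^3}} & \text{if } m+l-2=0 \text{ (that is, } S \text{ is a single vertex)},\end{cases}$$ where $f(n)\sim g(n)$ means $f(n)/g(n)\to1$. Moreover $a_{\mathcal{B}_n}(S)=g_{\mathcal{B}_n}(S)=0$ for every even $n$. -/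

import Mathlib

open Asymptotics Filter
open scoped BigOperators

/-- Finite rooted plane trees: a root together with an ordered sequence of `d` subtrees
(`d = 0` gives the one-vertex tree). -/
inductive PlaneTree : Type
  | node (d : ℕ) (c : Fin d → PlaneTree) : PlaneTree

namespace PlaneTree

/-- The number of vertices. -/
def size : PlaneTree → ℕ
  | node _ c => 1 + ∑ j, (c j).size

/-- `degreeCount i S` is the number of vertices of `S` with out-degree `i`
(exactly `i` children). -/
def degreeCount (i : ℕ) : PlaneTree → ℕ
  | node d c => (if d = i then 1 else 0) + ∑ j, (c j).degreeCount i

/-- The number of leaves, that is, of vertices without children. -/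
def leaves (S : PlaneTree) : ℕ := S.degreeCount 0

/-- The vertices, named by their addresses: the root is `[]`, and `j :: p` is the vertex with
address `p` in the `j`-th subtree of the root (subtrees are counted from left to right). Thus `p` is
an ancestor of `q`, or equal to it, iff `p <+: q` (the list `p` is a prefix of `q`), and the children
of `p` are the vertices `p ++ [0]`, `p ++ [1]`, … -/
def vertices : PlaneTree → Finset (List ℕ)
  | node _ c => insert [] (Finset.univ.biUnion fun j => (c j).vertices.image (List.cons (j : ℕ)))

/-- A binary tree: each vertex has either `0` or `2` children. -/
def IsBinary : PlaneTree → Prop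
  | node d c => (d = 0 ∨ d = 2) ∧ ∀ j, (c j).IsBinary

/-- `p` lies to the left of `q`: the two vertices belong to the subtrees of two different children
of some vertex `r`, and the child above `p` precedes the child above `q`. -/
def LeftOf (p q : List ℕ) : Prop :=
  ∃ (r : List ℕ) (i j : ℕ), i < j ∧ r ++ [i] <+: p ∧ r ++ [j] <+: q

/-- `E` is (the vertex set of) a plane embedding of `S` into `T`: the set `E` of vertices of `T`,
with the order inherited from `T`, is isomorphic to the poset `S` by an isomorphism which respects
the left-to-right order of the children of each vertex of `S`. -/
def IsEmbedding (S T : PlaneTree) (E : Finset (List ℕ)) : Prop :=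
  E ⊆ T.vertices ∧ ∃ f : List ℕ → List ℕ,
    Set.BijOn f (S.vertices : Set (List ℕ)) (E : Set (List ℕ)) ∧
    (∀ p ∈ S.vertices, ∀ q ∈ S.vertices, (p <+: q ↔ f p <+: f q)) ∧
    (∀ (r : List ℕ) (i j : ℕ), r ++ [i] ∈ S.vertices → r ++ [j] ∈ S.vertices → i < j →
      LeftOf (f (r ++ [i])) (f (r ++ [j])))

open Classical in
/-- `a_T(S)`, the number of embeddings of `S` into `T`. -/
noncomputable def numEmbeddings (S T : PlaneTree) : ℕ :=
  (T.vertices.powerset.filter fun E => IsEmbedding S T E).card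

open Classical in
/-- `g_T(S)`, the number of good embeddings of `S` into `T`: those that contain the root of `T`. -/
noncomputable def numGoodEmbeddings (S T : PlaneTree) : ℕ :=
  (T.vertices.powerset.filter fun E => IsEmbedding S T E ∧ [] ∈ E).card

theorem finite_binary (n : ℕ) : {T : PlaneTree | T.IsBinary ∧ T.size = n}.Finite := by
  induction n using Nat.strong_induction_on with
  | _ n ih =>
    have hfin : (⋃ k ∈ Set.Iio n, {T : PlaneTree | T.IsBinary ∧ T.size = k}).Finite :=
      (Set.finite_Iio n).biUnion fun k hk => ih k hk
    have key (d : ℕ) : (PlaneTree.node d '' (Set.univ.pi fun _ =>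
        ⋃ k ∈ Set.Iio n, {T : PlaneTree | T.IsBinary ∧ T.size = k})).Finite :=
      (Set.Finite.pi' fun _ => hfin).image _ |>.subset (by
        rintro _ ⟨c, hc, rfl⟩
        exact ⟨c, fun i => hc i trivial, rfl⟩)
    refine ((key 0).union (key 2)).subset ?_
    rintro ⟨d, c⟩ ⟨hb, hs⟩
    have hc : c ∈ Set.univ.pi fun _ : Fin d =>
        ⋃ k ∈ Set.Iio n, {T : PlaneTree | T.IsBinary ∧ T.size = k} := by
      intro j _
      have h1 : (c j).size ≤ ∑ j, (c j).size :=
        Finset.single_le_sum (f := fun j => (c j).size) (fun _ _ => Nat.zero_le _)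
          (Finset.mem_univ j)
      have h2 : 1 + ∑ j, (c j).size = n := hs
      exact Set.mem_biUnion (x := (c j).size) (by simp only [Set.mem_Iio]; omega) ⟨hb.2 j, rfl⟩
    rcases hb.1 with rfl | rfl
    · exact Or.inl ⟨c, hc, rfl⟩
    · exact Or.inr ⟨c, hc, rfl⟩

/-- `B_n`, the family of all plane binary trees with `n` vertices. -/
noncomputable def binaryTrees (n : ℕ) : Finset PlaneTree := (finite_binary n).toFinset

/-- `a_{B_n}(S)`, the total number of embeddings of `S` into the members of `B_n`. -/
noncomputable def totalEmbeddings (S : PlaneTree) (n : ℕ) : ℕ :=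
  ∑ T ∈ binaryTrees n, numEmbeddings S T

/-- `g_{B_n}(S)`, the total number of good embeddings of `S` into the members of `B_n`. -/
noncomputable def totalGoodEmbeddings (S : PlaneTree) (n : ℕ) : ℕ :=
  ∑ T ∈ binaryTrees n, numGoodEmbeddings S T

/-- The constant `C`: the product over `3 ≤ i ≤ m - 1` of the `d_i`-th powers of the Catalan
numbers of index `i - 1`, where `m` is the size of `S` and `d_i` the number of its vertices of
out-degree `i`. -/
def catalanFactor (S : PlaneTree) : ℕ :=
  ∏ i ∈ Finset.Icc 3 (S.size - 1), catalan (i - 1) ^ S.degreeCount i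

end PlaneTree

namespace PlaneTree

/-! Embeddings are counted through copies of ordered forests. Removing the root of a good copy of
`S` leaves a copy of the forest of root subtrees of `S` that avoids the root of `T`. If the root of
`T` has two subtrees, such a copy is cut at exactly one place: an initial segment of the forest lies
in the left subtree and the rest in the right one (`isForestCopy_graft`, `eq_of_isForestCopy_take`).
Hence the counts satisfy convolution recursions.

Let B, F, G be the generating functions of binary trees, of embeddings of `S` and of good embeddings
of `S`, and put R = 1 - 2XB. Then B = X + XB² gives R² = 1 - 4X². The two extreme cuts contribute
2XB times the forest series itself; moving them to the other side gives G = RF, and, for a forest of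
k + 1 trees, the Catalan recursion: R^k times its series is C_k X^k times the product of the series
of its trees. Induction on `S` yields `forestSeries_singleton`, in effect 2^l X R^(m+l-1) F = C (1 -
R)^(l+d_1).

As R = (1 - 4X²)^(1/2), expanding (1 - R)^(l+d_1) expresses the coefficients of F and G through
binomial coefficients, and `tendsto_multichoose` gives their growth n^(r-1)/Γ(r). The most negative
power of R dominates. For G the exponent is m+l-2; when it is 0 the leading term is a constant and
the next one, -R, takes over. -/

theorem nil_mem_vertices (T : PlaneTree) : [] ∈ T.vertices := by
  cases T; simp [vertices]

theorem cons_mem_vertices {d : ℕ} {c : Fin d → PlaneTree} {k : ℕ} {p : List ℕ} :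
    k :: p ∈ (node d c).vertices ↔ ∃ j : Fin d, (j : ℕ) = k ∧ p ∈ (c j).vertices := by
  simp only [vertices, Finset.mem_insert, Finset.mem_biUnion, Finset.mem_image, Finset.mem_univ,
    true_and, List.cons.injEq, reduceCtorEq, false_or]
  constructor
  · rintro ⟨j, q, hq, h1, rfl⟩; exact ⟨j, h1, hq⟩
  · rintro ⟨j, h1, hq⟩; exact ⟨j, p, hq, h1, rfl⟩

theorem cons_fin_mem_vertices {d : ℕ} {c : Fin d → PlaneTree} {j : Fin d} {p : List ℕ} :
    (j : ℕ) :: p ∈ (node d c).vertices ↔ p ∈ (c j).vertices := by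
  rw [cons_mem_vertices]
  exact ⟨fun ⟨i, hi, h⟩ => Fin.ext hi ▸ h, fun h => ⟨j, rfl, h⟩⟩

theorem vertices_cases {d : ℕ} {c : Fin d → PlaneTree} {p : List ℕ}
    (h : p ∈ (node d c).vertices) :
    p = [] ∨ ∃ (j : Fin d) (q : List ℕ), q ∈ (c j).vertices ∧ p = (j : ℕ) :: q := by
  cases p with
  | nil => exact Or.inl rfl
  | cons k p =>
    obtain ⟨j, rfl, hp⟩ := cons_mem_vertices.1 h
    exact Or.inr ⟨j, p, hp, rfl⟩

/-! ### The left-to-right order on addresses -/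

theorem LeftOf.mono {p q p' q' : List ℕ} (h : LeftOf p q) (hp : p <+: p') (hq : q <+: q') :
    LeftOf p' q' := by
  obtain ⟨r, i, j, hij, h1, h2⟩ := h
  exact ⟨r, i, j, hij, h1.trans hp, h2.trans hq⟩

theorem leftOf_cons {a b : ℕ} {p q : List ℕ} :
    LeftOf (a :: p) (b :: q) ↔ a < b ∨ a = b ∧ LeftOf p q := by
  constructor
  · rintro ⟨r, i, j, hij, h1, h2⟩
    cases r with
    | nil =>
      simp only [List.nil_append, List.cons_prefix_cons, List.nil_prefix, and_true] at h1 h2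
      subst h1 h2
      exact Or.inl hij
    | cons x r =>
      simp only [List.cons_append, List.cons_prefix_cons] at h1 h2
      exact Or.inr ⟨h1.1.symm.trans h2.1, r, i, j, hij, h1.2, h2.2⟩
  · rintro (h | ⟨rfl, r, i, j, hij, h1, h2⟩)
    · exact ⟨[], a, b, h, by simp, by simp⟩
    · exact ⟨a :: r, i, j, hij, by simpa using h1, by simpa using h2⟩

theorem not_leftOf_nil_left (q : List ℕ) : ¬ LeftOf [] q := by
  rintro ⟨r, i, j, hij, h1, h2⟩
  simp at h1

theorem not_leftOf_nil_right (p : List ℕ) : ¬ LeftOf p [] := by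
  rintro ⟨r, i, j, hij, h1, h2⟩
  simp at h2

theorem LeftOf.not_prefix {p q : List ℕ} (h : LeftOf p q) : ¬ p <+: q ∧ ¬ q <+: p := by
  induction p generalizing q with
  | nil => exact (not_leftOf_nil_left q h).elim
  | cons a p ih =>
    cases q with
    | nil => exact (not_leftOf_nil_right _ h).elim
    | cons b q =>
      rcases leftOf_cons.1 h with h' | ⟨rfl, h'⟩
      · simp [List.cons_prefix_cons]; omega
      · simpa [List.cons_prefix_cons] using ih h'

/-! ### Copies of trees and of ordered forests -/

/-- The vertex set `E`, with the prefix order and the left-to-right order, is a copy of `S`. -/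
def IsCopy (S : PlaneTree) (E : Finset (List ℕ)) : Prop :=
  ∃ f : List ℕ → List ℕ,
    Set.BijOn f (S.vertices : Set (List ℕ)) (E : Set (List ℕ)) ∧
    (∀ p ∈ S.vertices, ∀ q ∈ S.vertices, (p <+: q ↔ f p <+: f q)) ∧
    (∀ (r : List ℕ) (i j : ℕ), r ++ [i] ∈ S.vertices → r ++ [j] ∈ S.vertices → i < j →
      LeftOf (f (r ++ [i])) (f (r ++ [j])))

theorem isEmbedding_iff {S T : PlaneTree} {E : Finset (List ℕ)} :
    IsEmbedding S T E ↔ E ⊆ T.vertices ∧ IsCopy S E := Iff.rfl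

/-- Every element of `E` lies to the left of every element of `F`. -/
def SetLeftOf (E F : Finset (List ℕ)) : Prop := ∀ p ∈ E, ∀ q ∈ F, LeftOf p q

theorem IsCopy.card_eq {S : PlaneTree} {E : Finset (List ℕ)} (h : IsCopy S E) :
    E.card = S.vertices.card := by
  obtain ⟨f, hf, -⟩ := h
  have := hf.image_eq
  rw [← Finset.coe_image, Finset.coe_inj] at this
  rw [← this, Finset.card_image_of_injOn hf.injOn]

theorem IsCopy.exists_root {S : PlaneTree} {E : Finset (List ℕ)} (h : IsCopy S E) :
    ∃ v ∈ E, ∀ p ∈ E, v <+: p := by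
  obtain ⟨f, hf, ho, -⟩ := h
  refine ⟨f [], hf.mapsTo S.nil_mem_vertices, fun p hp => ?_⟩
  obtain ⟨q, hq, rfl⟩ := hf.surjOn hp
  exact (ho _ S.nil_mem_vertices _ hq).1 List.nil_prefix

theorem isCopy_image_cons {S : PlaneTree} {E : Finset (List ℕ)} (a : ℕ) :
    IsCopy S (E.image (List.cons a)) ↔ IsCopy S E := by
  constructor
  · rintro ⟨f, hf, ho, hl⟩
    have key : ∀ p ∈ S.vertices, f p = a :: (f p).tail ∧ (f p).tail ∈ E := by
      intro p hp
      have := hf.mapsTo hp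
      simp only [Finset.coe_image, Set.mem_image, Finset.mem_coe] at this
      obtain ⟨x, hx, h⟩ := this
      rw [← h]; exact ⟨rfl, hx⟩
    refine ⟨fun p => (f p).tail, ⟨fun p hp => (key p hp).2, fun p hp q hq h => ?_, fun e he => ?_⟩,
      fun p hp q hq => ?_, fun r i j hi hj hij => ?_⟩
    · refine hf.injOn hp hq ?_
      rw [(key p hp).1, (key q hq).1]
      exact congrArg (List.cons a) h
    · have he' : a :: e ∈ (E.image (List.cons a)) := Finset.mem_image_of_mem _ he
      obtain ⟨p, hp, h⟩ := hf.surjOn he'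
      exact ⟨p, hp, by simp [h]⟩
    · rw [ho p hp q hq, (key p hp).1, (key q hq).1]; simp [List.cons_prefix_cons]
    · have := hl r i j hi hj hij
      rw [(key _ hi).1, (key _ hj).1, leftOf_cons] at this
      simpa using this
  · rintro ⟨f, hf, ho, hl⟩
    refine ⟨fun p => a :: f p, ?_, fun p hp q hq => ?_, fun r i j hi hj hij => ?_⟩
    · rw [Finset.coe_image]
      exact (Set.BijOn.comp (List.cons_injective.injOn.bijOn_image) hf)
    · rw [ho p hp q hq, List.cons_prefix_cons]; simp
    · exact leftOf_cons.2 (Or.inr ⟨rfl, hl r i j hi hj hij⟩)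

/-- The definition orders only the images of siblings, but being left of passes down to descendants
(`LeftOf.mono`), so the images of whole sibling subtrees are ordered. -/
theorem IsCopy.exists_children {d : ℕ} {c : Fin d → PlaneTree} {E : Finset (List ℕ)}
    (h : IsCopy (node d c) E) :
    ∃ (v : List ℕ) (F : Fin d → Finset (List ℕ)), E = insert v (Finset.univ.biUnion F) ∧
      (∀ j, ∀ p ∈ F j, v <+: p ∧ p ≠ v) ∧ (∀ j, IsCopy (c j) (F j)) ∧
      ∀ i j, i < j → SetLeftOf (F i) (F j) := by
  obtain ⟨f, hf, ho, hl⟩ := h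
  refine ⟨f [], fun j => (c j).vertices.image fun p => f ((j : ℕ) :: p), ?_, ?_, ?_, ?_⟩
  · rw [← Finset.coe_inj, ← hf.image_eq, ← Finset.coe_image, Finset.coe_inj, vertices,
      Finset.image_insert, Finset.biUnion_image]
    simp only [Finset.image_image, Function.comp_def]
  · intro j p hp
    obtain ⟨q, hq, rfl⟩ := Finset.mem_image.1 hp
    have hq' := cons_fin_mem_vertices.2 hq
    refine ⟨(ho _ (nil_mem_vertices _) _ hq').1 List.nil_prefix, fun h => ?_⟩
    simpa using hf.injOn hq' (nil_mem_vertices _) h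
  · intro j
    refine ⟨fun p => f ((j : ℕ) :: p), ?_, fun p hp q hq => ?_, fun r i k hi hk hik => ?_⟩
    · rw [Finset.coe_image]
      refine Set.InjOn.bijOn_image fun p hp q hq h => ?_
      simpa using hf.injOn (cons_fin_mem_vertices.2 hp) (cons_fin_mem_vertices.2 hq) h
    · rw [← ho _ (cons_fin_mem_vertices.2 hp) _ (cons_fin_mem_vertices.2 hq), List.cons_prefix_cons]
      simp
    · exact hl ((j : ℕ) :: r) i k (cons_fin_mem_vertices.2 hi) (cons_fin_mem_vertices.2 hk) hik
  · intro i j hij x hx y hy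
    obtain ⟨p, hp, rfl⟩ := Finset.mem_image.1 hx
    obtain ⟨q, hq, rfl⟩ := Finset.mem_image.1 hy
    have hi := cons_fin_mem_vertices.2 (nil_mem_vertices (c i))
    have hj := cons_fin_mem_vertices.2 (nil_mem_vertices (c j))
    exact (hl [] i j hi hj hij).mono ((ho _ hi _ (cons_fin_mem_vertices.2 hp)).1 (by simp))
      ((ho _ hj _ (cons_fin_mem_vertices.2 hq)).1 (by simp))

/-- The maps of the subtrees glue to one map; vertices of different subtrees stay incomparable by
`LeftOf.not_prefix`. -/
theorem isCopy_of_children {d : ℕ} {c : Fin d → PlaneTree} {v : List ℕ}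
    {F : Fin d → Finset (List ℕ)} (hv : ∀ j, ∀ p ∈ F j, v <+: p ∧ p ≠ v)
    (hF : ∀ j, IsCopy (c j) (F j)) (hlt : ∀ i j, i < j → SetLeftOf (F i) (F j)) :
    IsCopy (node d c) (insert v (Finset.univ.biUnion F)) := by
  choose f hf ho hl using hF
  let g : List ℕ → List ℕ := fun p => match p with
    | [] => v
    -- The value `[]` is never used, since no vertex has a first step `k ≥ d`.
    | k :: p => if h : k < d then f ⟨k, h⟩ p else []
  have g0 : g [] = v := rfl
  have g1 : ∀ (j : Fin d) (p : List ℕ), g ((j : ℕ) :: p) = f j p := fun j p => by simp [g]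
  have mem : ∀ (j : Fin d) (p : List ℕ), p ∈ (c j).vertices → f j p ∈ F j :=
    fun j p hp => (hf j).mapsTo hp
  have hord : ∀ p ∈ (node d c).vertices, ∀ q ∈ (node d c).vertices, (p <+: q ↔ g p <+: g q) := by
    intro p hp q hq
    rcases vertices_cases hp with rfl | ⟨i, p, hp', rfl⟩ <;>
      rcases vertices_cases hq with rfl | ⟨j, q, hq', rfl⟩
    · simp
    · simp only [List.nil_prefix, true_iff, g0, g1]
      exact (hv j _ (mem j q hq')).1
    · simp only [g0, g1, List.prefix_nil, reduceCtorEq, false_iff]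
      intro h
      obtain ⟨h1, h2⟩ := hv i _ (mem i p hp')
      exact h2 (h.eq_of_length (le_antisymm h.length_le h1.length_le))
    · rw [g1, g1, List.cons_prefix_cons]
      rcases lt_trichotomy i j with h | rfl | h
      · have := (hlt i j h _ (mem i p hp') _ (mem j q hq')).not_prefix.1
        simp [this]; intro h'; omega
      · simpa using ho i p hp' q hq'
      · have := (hlt j i h _ (mem j q hq') _ (mem i p hp')).not_prefix.2
        simp [this]; intro h'; omega
  refine ⟨g, ⟨fun p hp => ?_, fun p hp q hq h => ?_, fun e he => ?_⟩, hord,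
    fun r i j hi hj hij => ?_⟩
  · rcases vertices_cases hp with rfl | ⟨i, p, hp', rfl⟩
    · simp [g0]
    · rw [g1]
      simpa using Or.inr ⟨i, mem i p hp'⟩
  -- Injectivity comes from order reflection: equal images make each address a prefix of the other.
  · have h1 := (hord p hp q hq).2 (h ▸ List.prefix_rfl)
    have h2 := (hord q hq p hp).2 (h ▸ List.prefix_rfl)
    exact h1.eq_of_length (le_antisymm h1.length_le h2.length_le)
  · simp only [Finset.coe_insert, Finset.coe_biUnion, Finset.coe_univ, Set.mem_univ,
      Set.iUnion_true, Set.mem_insert_iff, Set.mem_iUnion] at he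
    rcases he with rfl | ⟨j, he⟩
    · exact ⟨[], nil_mem_vertices _, rfl⟩
    · obtain ⟨p, hp, rfl⟩ := (hf j).surjOn he
      exact ⟨(j : ℕ) :: p, cons_fin_mem_vertices.2 hp, g1 j p⟩
  · cases r with
    | nil =>
      obtain ⟨i, rfl, hi'⟩ := cons_mem_vertices.1 hi
      obtain ⟨j, rfl, hj'⟩ := cons_mem_vertices.1 hj
      simp only [List.nil_append, g1]
      exact hlt i j hij _ (mem _ _ hi') _ (mem _ _ hj')
    | cons k r =>
      obtain ⟨k, rfl, hi'⟩ := cons_mem_vertices.1 hi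
      have hj' := cons_fin_mem_vertices.1 hj
      simp only [List.cons_append, g1]
      exact hl k r i j hi' hj' hij

/-- `E` is a copy of the ordered forest `cs`. -/
def IsForestCopy : List PlaneTree → Finset (List ℕ) → Prop
  | [], E => E = ∅
  | S :: cs, E => ∃ E₁ E₂, E = E₁ ∪ E₂ ∧ IsCopy S E₁ ∧ IsForestCopy cs E₂ ∧ SetLeftOf E₁ E₂

theorem isForestCopy_ofFn {d : ℕ} {c : Fin d → PlaneTree} {E : Finset (List ℕ)} :
    IsForestCopy (List.ofFn c) E ↔ ∃ F : Fin d → Finset (List ℕ), E = Finset.univ.biUnion F ∧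
      (∀ j, IsCopy (c j) (F j)) ∧ ∀ i j, i < j → SetLeftOf (F i) (F j) := by
  induction d generalizing E with
  | zero => simp [IsForestCopy]
  | succ d ih =>
    rw [List.ofFn_succ, IsForestCopy]
    constructor
    · rintro ⟨E₁, E₂, rfl, h1, h2, h3⟩
      obtain ⟨F, rfl, hF, hlt⟩ := ih.1 h2
      refine ⟨Fin.cons E₁ F, ?_, ?_, ?_⟩
      · ext p; simp [Fin.exists_fin_succ]
      · intro j; cases j using Fin.cases with
        | zero => simpa using h1
        | succ j => simpa using hF j
      · intro i j hij
        cases j using Fin.cases with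
        | zero => simp at hij
        | succ j =>
          cases i using Fin.cases with
          | zero =>
            intro p hp q hq
            exact h3 p (by simpa using hp) q (by simpa using ⟨j, by simpa using hq⟩)
          | succ i => simpa using hlt i j (by simpa using hij)
    · rintro ⟨F, rfl, hF, hlt⟩
      refine ⟨F 0, Finset.univ.biUnion fun j => F j.succ, ?_, hF 0,
        ih.2 ⟨_, rfl, fun j => hF _, fun i j hij => hlt _ _ (by simpa using hij)⟩, ?_⟩
      · ext p; simp [Fin.exists_fin_succ]
      · intro p hp q hq
        simp only [Finset.mem_biUnion, Finset.mem_univ, true_and] at hq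
        obtain ⟨j, hq⟩ := hq
        exact hlt 0 j.succ (Fin.succ_pos j) p hp q hq

theorem isCopy_node {d : ℕ} {c : Fin d → PlaneTree} {E : Finset (List ℕ)} :
    IsCopy (node d c) E ↔ ∃ (v : List ℕ) (E' : Finset (List ℕ)), E = insert v E' ∧
      (∀ p ∈ E', v <+: p ∧ p ≠ v) ∧ IsForestCopy (List.ofFn c) E' := by
  constructor
  · intro h
    obtain ⟨v, F, rfl, hv, hF, hlt⟩ := h.exists_children
    refine ⟨v, _, rfl, ?_, isForestCopy_ofFn.2 ⟨F, rfl, hF, hlt⟩⟩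
    intro p hp
    simp only [Finset.mem_biUnion, Finset.mem_univ, true_and] at hp
    exact hp.elim fun j hj => hv j p hj
  · rintro ⟨v, E', rfl, hv, h⟩
    obtain ⟨F, rfl, hF, hlt⟩ := isForestCopy_ofFn.1 h
    exact isCopy_of_children
      (fun j p hp => hv p (Finset.mem_biUnion.2 ⟨j, Finset.mem_univ _, hp⟩)) hF hlt

theorem isForestCopy_singleton {S : PlaneTree} {E : Finset (List ℕ)} :
    IsForestCopy [S] E ↔ IsCopy S E := by
  simp [IsForestCopy, SetLeftOf]

theorem isForestCopy_append {l₁ l₂ : List PlaneTree} {E : Finset (List ℕ)} :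
    IsForestCopy (l₁ ++ l₂) E ↔ ∃ E₁ E₂, E = E₁ ∪ E₂ ∧ IsForestCopy l₁ E₁ ∧ IsForestCopy l₂ E₂ ∧
      SetLeftOf E₁ E₂ := by
  induction l₁ generalizing E with
  | nil => simp [IsForestCopy, SetLeftOf]
  | cons S l ih =>
    simp only [List.cons_append, IsForestCopy, ih]
    constructor
    · rintro ⟨E₁, _, rfl, h1, ⟨E₂, E₃, rfl, h2, h3, h4⟩, h5⟩
      refine ⟨E₁ ∪ E₂, E₃, by rw [Finset.union_assoc],
        ⟨E₁, E₂, rfl, h1, h2, fun p hp q hq => h5 p hp q (Finset.mem_union_left _ hq)⟩, h3, ?_⟩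
      intro p hp q hq
      rcases Finset.mem_union.1 hp with hp | hp
      · exact h5 p hp q (Finset.mem_union_right _ hq)
      · exact h4 p hp q hq
    · rintro ⟨_, E₃, rfl, ⟨E₁, E₂, rfl, h1, h2, h5⟩, h3, h4⟩
      refine ⟨E₁, E₂ ∪ E₃, by rw [Finset.union_assoc], h1, ⟨E₂, E₃, rfl, h2, h3,
        fun p hp q hq => h4 p (Finset.mem_union_right _ hp) q hq⟩, ?_⟩
      intro p hp q hq
      rcases Finset.mem_union.1 hq with hq | hq
      · exact h5 p hp q hq
      · exact h4 p (Finset.mem_union_left _ hp) q hq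

theorem isForestCopy_image_cons {cs : List PlaneTree} {E : Finset (List ℕ)} (a : ℕ) :
    IsForestCopy cs (E.image (List.cons a)) ↔ IsForestCopy cs E := by
  induction cs generalizing E with
  | nil => simp [IsForestCopy]
  | cons S cs ih =>
    simp only [IsForestCopy]
    constructor
    · rintro ⟨E₁, E₂, h, h1, h2, h3⟩
      obtain ⟨F₁, -, rfl⟩ := Finset.subset_image_iff.1 (h ▸ Finset.subset_union_left : E₁ ⊆ _)
      obtain ⟨F₂, -, rfl⟩ := Finset.subset_image_iff.1 (h ▸ Finset.subset_union_right : E₂ ⊆ _)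
      rw [← Finset.image_union] at h
      refine ⟨F₁, F₂, Finset.image_injective List.cons_injective h, (isCopy_image_cons a).1 h1,
        ih.1 h2, fun p hp q hq => ?_⟩
      have := h3 _ (Finset.mem_image_of_mem _ hp) _ (Finset.mem_image_of_mem _ hq)
      simpa [leftOf_cons] using this
    · rintro ⟨E₁, E₂, rfl, h1, h2, h3⟩
      refine ⟨_, _, Finset.image_union _ _, (isCopy_image_cons a).2 h1, ih.2 h2, ?_⟩
      intro x hx y hy
      obtain ⟨p, hp, rfl⟩ := Finset.mem_image.1 hx
      obtain ⟨q, hq, rfl⟩ := Finset.mem_image.1 hy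
      exact leftOf_cons.2 (Or.inr ⟨rfl, h3 p hp q hq⟩)

/-! ### Cutting a forest copy between two subtrees -/

/-- The vertex set consisting of `E₀` in the left subtree and `E₁` in the right subtree. -/
def graft (E₀ E₁ : Finset (List ℕ)) : Finset (List ℕ) :=
  E₀.image (List.cons 0) ∪ E₁.image (List.cons 1)

theorem zero_cons_mem_graft {E₀ E₁ : Finset (List ℕ)} {p : List ℕ} :
    0 :: p ∈ graft E₀ E₁ ↔ p ∈ E₀ := by simp [graft]

theorem one_cons_mem_graft {E₀ E₁ : Finset (List ℕ)} {p : List ℕ} :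
    1 :: p ∈ graft E₀ E₁ ↔ p ∈ E₁ := by simp [graft]

theorem mem_graft_cases {E₀ E₁ : Finset (List ℕ)} {p : List ℕ} (h : p ∈ graft E₀ E₁) :
    (∃ q ∈ E₀, p = 0 :: q) ∨ ∃ q ∈ E₁, p = 1 :: q := by
  simp only [graft, Finset.mem_union, Finset.mem_image] at h
  rcases h with ⟨q, hq, rfl⟩ | ⟨q, hq, rfl⟩
  · exact Or.inl ⟨q, hq, rfl⟩
  · exact Or.inr ⟨q, hq, rfl⟩

theorem graft_inj {E₀ E₁ F₀ F₁ : Finset (List ℕ)} (h : graft E₀ E₁ = graft F₀ F₁) :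
    E₀ = F₀ ∧ E₁ = F₁ := by
  constructor
  · ext p; rw [← zero_cons_mem_graft (E₁ := E₁), h, zero_cons_mem_graft]
  · ext p; rw [← one_cons_mem_graft (E₀ := E₀), h, one_cons_mem_graft]

theorem exists_eq_graft {E E₀ E₁ : Finset (List ℕ)} (h : E ⊆ graft E₀ E₁) :
    ∃ F₀ F₁, F₀ ⊆ E₀ ∧ F₁ ⊆ E₁ ∧ E = graft F₀ F₁ := by
  obtain ⟨A, B, hA, hB, rfl⟩ : ∃ A B, A ⊆ E₀.image (List.cons 0) ∧ B ⊆ E₁.image (List.cons 1) ∧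
      E = A ∪ B :=
    ⟨E ∩ E₀.image (List.cons 0), E ∩ E₁.image (List.cons 1), Finset.inter_subset_right,
      Finset.inter_subset_right, by
        rw [← Finset.inter_union_distrib_left]; exact (Finset.inter_eq_left.2 h).symm⟩
  obtain ⟨F₀, h0, rfl⟩ := Finset.subset_image_iff.1 hA
  obtain ⟨F₁, h1, rfl⟩ := Finset.subset_image_iff.1 hB
  exact ⟨F₀, F₁, h0, h1, rfl⟩

/-- A copy of a tree lies on the same side as its root. If the first tree is on the left, induct on
the others; if it is on the right, nothing after it can be on the left, so the cut is at 0. -/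
theorem isForestCopy_graft {cs : List PlaneTree} {E₀ E₁ : Finset (List ℕ)} :
    IsForestCopy cs (graft E₀ E₁) ↔
      ∃ i ≤ cs.length, IsForestCopy (cs.take i) E₀ ∧ IsForestCopy (cs.drop i) E₁ := by
  constructor
  · induction cs generalizing E₀ E₁ with
    | nil =>
      intro h
      simp only [IsForestCopy, graft, Finset.union_eq_empty, Finset.image_eq_empty] at h
      exact ⟨0, le_rfl, h.1, h.2⟩
    | cons S cs ih =>
      intro hS
      obtain ⟨A, B, h, hA, hB, hAB⟩ := id hS
      obtain ⟨v, hv, hroot⟩ := hA.exists_root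
      obtain ⟨A₀, A₁, -, -, rfl⟩ := exists_eq_graft (h ▸ Finset.subset_union_left : A ⊆ _)
      obtain ⟨B₀, B₁, -, -, rfl⟩ := exists_eq_graft (h ▸ Finset.subset_union_right : B ⊆ _)
      have hE : E₀ = A₀ ∪ B₀ ∧ E₁ = A₁ ∪ B₁ := by
        apply graft_inj
        rw [h]
        simp only [graft, Finset.image_union]
        ac_rfl
      obtain ⟨rfl, rfl⟩ := hE
      rcases mem_graft_cases hv with ⟨w, hw, rfl⟩ | ⟨w, hw, rfl⟩
      · have hA1 : A₁ = ∅ := by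
          refine Finset.eq_empty_of_forall_notMem fun p hp => ?_
          simpa using hroot _ (one_cons_mem_graft.2 hp)
        subst hA1
        obtain ⟨i, hi, h1, h2⟩ := ih hB
        refine ⟨i + 1, by simpa using hi, ⟨A₀, B₀, rfl, ?_, h1, ?_⟩, by simpa using h2⟩
        · rw [← isCopy_image_cons 0]
          simpa [graft] using hA
        · intro p hp q hq
          have := hAB _ (zero_cons_mem_graft.2 hp) _ (zero_cons_mem_graft.2 hq)
          simpa [leftOf_cons] using this
      · have hA0 : A₀ = ∅ := by
          refine Finset.eq_empty_of_forall_notMem fun p hp => ?_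
          simpa using hroot _ (zero_cons_mem_graft.2 hp)
        have hB0 : B₀ = ∅ := by
          refine Finset.eq_empty_of_forall_notMem fun p hp => ?_
          have := hAB _ hv _ (zero_cons_mem_graft.2 hp)
          simp [leftOf_cons] at this
        subst hA0 hB0
        refine ⟨0, Nat.zero_le _, by simp [IsForestCopy], ?_⟩
        rw [← isForestCopy_image_cons 1]
        simpa [graft] using hS
  · rintro ⟨i, -, h0, h1⟩
    rw [← List.take_append_drop i cs, isForestCopy_append]
    refine ⟨_, _, rfl, (isForestCopy_image_cons 0).2 h0, (isForestCopy_image_cons 1).2 h1, ?_⟩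
    intro x hx y hy
    obtain ⟨p, hp, rfl⟩ := Finset.mem_image.1 hx
    obtain ⟨q, hq, rfl⟩ := Finset.mem_image.1 hy
    exact leftOf_cons.2 (Or.inl zero_lt_one)

theorem IsCopy.nonempty {S : PlaneTree} {E : Finset (List ℕ)} (h : IsCopy S E) : E.Nonempty :=
  h.exists_root.elim fun v hv => ⟨v, hv.1⟩

theorem IsForestCopy.card_eq {cs : List PlaneTree} {E : Finset (List ℕ)} (h : IsForestCopy cs E) :
    E.card = (cs.map fun S => S.vertices.card).sum := by
  induction cs generalizing E with
  | nil => simp only [IsForestCopy] at h; simp [h]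
  | cons S cs ih =>
    obtain ⟨E₁, E₂, rfl, h1, h2, h3⟩ := h
    rw [Finset.card_union_of_disjoint, ih h2, h1.card_eq]
    · simp
    · rw [Finset.disjoint_left]
      exact fun p hp hq => (h3 p hp p hq).not_prefix.1 List.prefix_rfl

theorem isForestCopy_empty {cs : List PlaneTree} : IsForestCopy cs ∅ ↔ cs = [] := by
  cases cs with
  | nil => simp [IsForestCopy]
  | cons S cs =>
    simp only [IsForestCopy, reduceCtorEq, iff_false]
    rintro ⟨E₁, E₂, h, h1, -⟩
    have := h1.nonempty
    rw [(Finset.union_eq_empty.1 h.symm).1] at this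
    exact Finset.not_nonempty_empty this

/-- The set determines the cut: trees are nonempty, so longer initial segments have strictly more
vertices. -/
theorem eq_of_isForestCopy_take {cs : List PlaneTree} {E : Finset (List ℕ)} {i j : ℕ}
    (hi : i ≤ cs.length) (hj : j ≤ cs.length)
    (h1 : IsForestCopy (cs.take i) E) (h2 : IsForestCopy (cs.take j) E) : i = j := by
  wlog hij : i ≤ j generalizing i j
  · exact (this hj hi h2 h1 (le_of_not_ge hij)).symm
  have hsplit : cs.take j = cs.take i ++ (cs.take j).drop i := by
    conv_lhs => rw [← List.take_append_drop i (cs.take j), List.take_take, min_eq_left hij]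
  have hc := h2.card_eq
  rw [hsplit, List.map_append, List.sum_append, ← h1.card_eq] at hc
  have hz : (((cs.take j).drop i).map fun S => S.vertices.card).sum = 0 := by omega
  have hnil : (cs.take j).drop i = [] := by
    rw [List.eq_nil_iff_forall_not_mem]
    intro S hS
    have h0 := List.sum_eq_zero_iff.1 hz _ (List.mem_map_of_mem hS)
    rw [Finset.card_eq_zero] at h0
    simpa [h0] using S.nil_mem_vertices
  have := congrArg List.length hnil
  simp only [List.length_drop, List.length_take, List.length_nil] at this
  omega

/-- With two or more trees, every vertex of the copy is left or right of some other one, which the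
root, comparable to everything, is not. -/
theorem nil_notMem_of_isForestCopy {cs : List PlaneTree} {E : Finset (List ℕ)}
    (h : IsForestCopy cs E) (hcs : cs.length ≠ 1) : [] ∉ E := by
  cases cs with
  | nil => simp only [IsForestCopy] at h; simp [h]
  | cons S cs =>
    cases cs with
    | nil => simp at hcs
    | cons S' cs =>
      obtain ⟨E₁, E₂, rfl, h1, ⟨E₃, E₄, rfl, h2, -⟩, h3⟩ := h
      intro hm
      rcases Finset.mem_union.1 hm with hm | hm
      · obtain ⟨q, hq⟩ := h2.nonempty
        exact not_leftOf_nil_left _ (h3 _ hm q (Finset.mem_union_left _ hq))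
      · obtain ⟨q, hq⟩ := h1.nonempty
        exact not_leftOf_nil_right _ (h3 q hq _ hm)

/-! ### Counting copies in a single binary tree -/

open Classical in
/-- The number of copies of the ordered forest `cs` in `T`. -/
noncomputable def forestCount (cs : List PlaneTree) (T : PlaneTree) : ℕ :=
  (T.vertices.powerset.filter fun E => IsForestCopy cs E).card

open Classical in
/-- The number of copies of the ordered forest `cs` in `T` which avoid the root of `T`. -/
noncomputable def innerCount (cs : List PlaneTree) (T : PlaneTree) : ℕ :=
  (T.vertices.powerset.filter fun E => IsForestCopy cs E ∧ [] ∉ E).card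

theorem numEmbeddings_eq (S T : PlaneTree) : numEmbeddings S T = forestCount [S] T := by
  unfold numEmbeddings forestCount
  congr 1
  ext E
  simp only [Finset.mem_filter, Finset.mem_powerset, isEmbedding_iff, isForestCopy_singleton]
  tauto

/-- Erasing `[]` and inserting it are mutually inverse, because a copy containing `[]` has it as its
root. -/
theorem numGoodEmbeddings_node {d : ℕ} (c : Fin d → PlaneTree) (T : PlaneTree) :
    numGoodEmbeddings (node d c) T = innerCount (List.ofFn c) T := by
  unfold numGoodEmbeddings innerCount
  refine Finset.card_bij' (fun E _ => E.erase []) (fun E _ => insert [] E) ?_ ?_ ?_ ?_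
  · intro E hE
    simp only [Finset.mem_filter, Finset.mem_powerset, isEmbedding_iff, isCopy_node] at hE ⊢
    obtain ⟨hT, ⟨-, v, E', rfl, hv, hf⟩, h0⟩ := hE
    have hv0 : v = [] := by
      rcases Finset.mem_insert.1 h0 with h | h
      · exact h.symm
      · exact List.prefix_nil.1 (hv _ h).1
    subst hv0
    have : ([] : List ℕ) ∉ E' := fun h => (hv _ h).2 rfl
    rw [Finset.erase_insert this]
    exact ⟨(Finset.subset_insert _ _).trans hT, hf, this⟩
  · intro E hE
    simp only [Finset.mem_filter, Finset.mem_powerset, isEmbedding_iff, isCopy_node] at hE ⊢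
    obtain ⟨hT, hf, h0⟩ := hE
    have hT' := Finset.insert_subset T.nil_mem_vertices hT
    exact ⟨hT', ⟨hT', [], E, rfl, fun p hp => ⟨List.nil_prefix, fun h => h0 (h ▸ hp)⟩, hf⟩,
      Finset.mem_insert_self _ _⟩
  · intro E hE
    simp only [Finset.mem_filter] at hE
    exact Finset.insert_erase hE.2.2
  · intro E hE
    simp only [Finset.mem_filter] at hE
    exact Finset.erase_insert hE.2.2

theorem forestCount_of_length_ne_one {cs : List PlaneTree} (hcs : cs.length ≠ 1) (T : PlaneTree) :
    forestCount cs T = innerCount cs T := by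
  unfold forestCount innerCount
  congr 1
  ext E
  simp only [Finset.mem_filter]
  exact and_congr_right fun _ => ⟨fun h => ⟨h, nil_notMem_of_isForestCopy h hcs⟩, And.left⟩

theorem forestCount_singleton (S T : PlaneTree) :
    forestCount [S] T = innerCount [S] T + numGoodEmbeddings S T := by
  classical
  unfold forestCount innerCount numGoodEmbeddings
  rw [← Finset.card_filter_add_card_filter_not (p := fun E => [] ∉ E), Finset.filter_filter,
    Finset.filter_filter]
  congr 2
  ext E
  simp only [Finset.mem_filter, Finset.mem_powerset, isEmbedding_iff, isForestCopy_singleton]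
  tauto

theorem vertices_leaf (c : Fin 0 → PlaneTree) : (node 0 c).vertices = {[]} := by
  simp [vertices]

theorem vertices_binary (c : Fin 2 → PlaneTree) :
    (node 2 c).vertices = insert [] (graft (c 0).vertices (c 1).vertices) := by
  ext p
  simp [vertices, graft, Fin.exists_fin_two]

theorem innerCount_leaf (cs : List PlaneTree) (c : Fin 0 → PlaneTree) :
    innerCount cs (node 0 c) = if cs = [] then 1 else 0 := by
  unfold innerCount
  have : ∀ E : Finset (List ℕ), (E ⊆ {[]} ∧ IsForestCopy cs E ∧ [] ∉ E) ↔ (E = ∅ ∧ cs = []) := by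
    intro E
    constructor
    · rintro ⟨h1, h2, h3⟩
      have : E = ∅ := by
        rcases Finset.subset_singleton_iff.1 h1 with h | h
        · exact h
        · simp [h] at h3
      subst this
      exact ⟨rfl, isForestCopy_empty.1 h2⟩
    · rintro ⟨rfl, h⟩
      exact ⟨by simp, isForestCopy_empty.2 h, by simp⟩
  split_ifs with h
  · rw [Finset.card_eq_one]
    refine ⟨∅, ?_⟩
    ext E
    simp only [Finset.mem_filter, Finset.mem_powerset, vertices_leaf, this, Finset.mem_singleton,
      and_iff_left h]
  · rw [Finset.card_eq_zero]
    ext E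
    simp only [Finset.mem_filter, Finset.mem_powerset, vertices_leaf, this, h, and_false,
      Finset.notMem_empty]

/-- Sets avoiding the root are grafts. Disjointness of the terms for different `i` is the uniqueness
of the cut. -/
theorem innerCount_binary (cs : List PlaneTree) (c : Fin 2 → PlaneTree) :
    innerCount cs (node 2 c) = ∑ i ∈ Finset.range (cs.length + 1),
      forestCount (cs.take i) (c 0) * forestCount (cs.drop i) (c 1) := by
  classical
  unfold innerCount forestCount
  simp only [← Finset.card_product]
  rw [← Finset.card_sigma]
  symm
  refine Finset.card_bij (fun x _ => graft x.2.1 x.2.2) ?_ ?_ ?_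
  · rintro ⟨i, E₀, E₁⟩ h
    simp only [Finset.mem_sigma, Finset.mem_range, Finset.mem_product, Finset.mem_filter,
      Finset.mem_powerset] at h ⊢
    obtain ⟨hi, ⟨h0, h0'⟩, h1, h1'⟩ := h
    refine ⟨?_, isForestCopy_graft.2 ⟨i, by omega, h0', h1'⟩, by simp [graft]⟩
    rw [vertices_binary]
    exact (Finset.union_subset_union (Finset.image_subset_image h0)
      (Finset.image_subset_image h1)).trans (Finset.subset_insert _ _)
  · rintro ⟨i, E₀, E₁⟩ h ⟨j, F₀, F₁⟩ h' heq
    simp only [Finset.mem_sigma, Finset.mem_range, Finset.mem_product, Finset.mem_filter,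
      Finset.mem_powerset] at h h'
    obtain ⟨rfl, rfl⟩ := graft_inj heq
    obtain rfl := eq_of_isForestCopy_take (by omega) (by omega) h.2.1.2 h'.2.1.2
    rfl
  · intro E hE
    simp only [Finset.mem_filter, Finset.mem_powerset, vertices_binary] at hE
    obtain ⟨hT, hE, h0⟩ := hE
    obtain ⟨E₀, E₁, hE0, hE1, rfl⟩ :=
      exists_eq_graft ((Finset.subset_insert_iff_of_notMem h0).1 hT)
    obtain ⟨i, hi, h1, h2⟩ := isForestCopy_graft.1 hE
    refine ⟨⟨i, E₀, E₁⟩, ?_, rfl⟩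
    simp only [Finset.mem_sigma, Finset.mem_range, Finset.mem_product, Finset.mem_filter,
      Finset.mem_powerset]
    exact ⟨by omega, ⟨hE0, h1⟩, hE1, h2⟩

/-! ### Decomposing binary trees at the root -/

theorem mem_binaryTrees {n : ℕ} {T : PlaneTree} :
    T ∈ binaryTrees n ↔ T.IsBinary ∧ T.size = n := by
  simp [binaryTrees]

theorem size_pos (T : PlaneTree) : 0 < T.size := by
  cases T; simp only [size]; omega

theorem binaryTrees_zero : binaryTrees 0 = ∅ := by
  ext T
  have := T.size_pos
  simp only [mem_binaryTrees, Finset.notMem_empty, iff_false]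
  omega

theorem IsBinary.odd_size {T : PlaneTree} (h : T.IsBinary) : Odd T.size := by
  induction T with
  | node d c ih =>
    obtain ⟨h0, h1⟩ := h
    rcases h0 with rfl | rfl
    · simp [size]
    · obtain ⟨a, ha⟩ := ih 0 (h1 0)
      obtain ⟨b, hb⟩ := ih 1 (h1 1)
      refine ⟨a + b + 1, ?_⟩
      simp only [size, Fin.sum_univ_two, ha, hb]
      ring

theorem binaryTrees_of_even {n : ℕ} (hn : Even n) : binaryTrees n = ∅ := by
  ext T
  simp only [mem_binaryTrees, Finset.notMem_empty, iff_false]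
  rintro ⟨h, rfl⟩
  exact Nat.not_even_iff_odd.2 h.odd_size hn

theorem sum_binaryTrees_succ {M : Type*} [AddCommMonoid M] (φ : PlaneTree → M) (n : ℕ) :
    ∑ T ∈ binaryTrees (n + 1), φ T = (if n = 0 then φ (node 0 Fin.elim0) else 0) +
      ∑ ij ∈ Finset.HasAntidiagonal.antidiagonal n, ∑ T₀ ∈ binaryTrees ij.1, ∑ T₁ ∈ binaryTrees ij.2,
        φ (node 2 ![T₀, T₁]) := by
  classical
  have hset : binaryTrees (n + 1) = (if n = 0 then {node 0 Fin.elim0} else ∅) ∪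
      (Finset.HasAntidiagonal.antidiagonal n).biUnion fun ij => (binaryTrees ij.1 ×ˢ binaryTrees ij.2).image
        fun t => node 2 ![t.1, t.2] := by
    ext T
    simp only [mem_binaryTrees, Finset.mem_union, Finset.mem_biUnion, Finset.mem_image,
      Finset.mem_product, Finset.HasAntidiagonal.mem_antidiagonal, Prod.exists]
    constructor
    · rintro ⟨hb, hs⟩
      obtain ⟨d, c⟩ := T
      obtain ⟨h0, h1⟩ := hb
      rcases h0 with rfl | rfl
      · left
        have : n = 0 := by simpa [size] using hs.symm
        rw [if_pos this, Finset.mem_singleton]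
        congr
        exact Subsingleton.elim _ _
      · right
        refine ⟨(c 0).size, (c 1).size, ?_, c 0, c 1, ⟨⟨h1 0, rfl⟩, h1 1, rfl⟩, ?_⟩
        · simp only [size, Fin.sum_univ_two] at hs; omega
        · congr
          ext i
          fin_cases i <;> rfl
    · rintro (h | ⟨i, j, hij, a, b, ⟨⟨ha, ha'⟩, hb, hb'⟩, rfl⟩)
      · split_ifs at h with hn
        · rw [Finset.mem_singleton] at h
          subst h hn
          exact ⟨⟨Or.inl rfl, fun j => j.elim0⟩, by simp [size]⟩
        · simp at h
      · refine ⟨⟨Or.inr rfl, fun j => ?_⟩, ?_⟩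
        · fin_cases j
          · exact ha
          · exact hb
        · simp [size, ha', hb']; omega
  have hinj : ∀ a b a' b' : PlaneTree, node 2 ![a, b] = node 2 ![a', b'] → a = a' ∧ b = b' := by
    intro a b a' b' h
    simpa using h
  rw [hset, Finset.sum_union, Finset.sum_biUnion]
  · congr 1
    · split_ifs <;> simp
    · refine Finset.sum_congr rfl fun ij _ => ?_
      rw [Finset.sum_image, Finset.sum_product]
      rintro ⟨a, b⟩ - ⟨a', b'⟩ - h
      obtain ⟨rfl, rfl⟩ := hinj _ _ _ _ h
      rfl
  · rintro ⟨i, j⟩ - ⟨i', j'⟩ - hne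
    rw [Function.onFun, Finset.disjoint_left]
    intro T hT hT'
    simp only [Finset.mem_image, Finset.mem_product, mem_binaryTrees, Prod.exists] at hT hT'
    obtain ⟨a, b, h1, rfl⟩ := hT
    obtain ⟨a', b', h2, h⟩ := hT'
    obtain ⟨rfl, rfl⟩ := hinj _ _ _ _ h
    exact hne (by rw [← h1.1.2, ← h1.2.2, h2.1.2, h2.2.2])
  · rw [Finset.disjoint_left]
    intro T hT hT'
    split_ifs at hT with hn
    · rw [Finset.mem_singleton] at hT
      subst hT
      simp at hT'
    · simp at hT

/-! ### Generating functions -/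

open PowerSeries

/-- The generating function `∑ φ(T) X ^ |T|` over all binary trees `T`. -/
noncomputable def gf (φ : PlaneTree → ℕ) : ℝ⟦X⟧ :=
  PowerSeries.mk fun n => ((∑ T ∈ binaryTrees n, φ T : ℕ) : ℝ)

/-- Summing over pairs of subtrees with prescribed total size is a Cauchy product; the outer `X`
accounts for the root. -/
theorem gf_eq {ι : Type*} (s : Finset ι) (φ : PlaneTree → ℕ) (ψ χ : ι → PlaneTree → ℕ)
    (h : ∀ T₀ T₁, φ (node 2 ![T₀, T₁]) = ∑ i ∈ s, ψ i T₀ * χ i T₁) :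
    gf φ = X * C ((φ (node 0 Fin.elim0) : ℕ) : ℝ) + X * ∑ i ∈ s, gf (ψ i) * gf (χ i) := by
  rw [← mul_add]
  ext n
  cases n with
  | zero => simp [gf, binaryTrees_zero]
  | succ n =>
    rw [coeff_succ_X_mul, map_add, map_sum, gf, coeff_mk, sum_binaryTrees_succ, Nat.cast_add,
      coeff_C]
    congr 1
    · split_ifs <;> simp
    · simp only [coeff_mul, gf, coeff_mk, h]
      rw [Finset.sum_comm]
      push_cast
      refine Finset.sum_congr rfl fun ij _ => ?_
      simp only [Finset.sum_mul_sum]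
      refine (Finset.sum_congr rfl fun T₀ _ => Finset.sum_comm).trans ?_
      rw [Finset.sum_comm]

/-- The generating function of the copies of the ordered forest `cs` in binary trees. -/
noncomputable def forestSeries (cs : List PlaneTree) : ℝ⟦X⟧ := gf (forestCount cs)

theorem gf_innerCount (cs : List PlaneTree) :
    gf (innerCount cs) = X * (if cs = [] then 1 else 0) + X * ∑ i ∈ Finset.range (cs.length + 1),
      forestSeries (cs.take i) * forestSeries (cs.drop i) := by
  rw [gf_eq (Finset.range (cs.length + 1)) (innerCount cs) (fun i => forestCount (cs.take i))
    (fun i => forestCount (cs.drop i)), innerCount_leaf]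
  · congr 2
    split_ifs <;> simp
  · intro T₀ T₁
    rw [innerCount_binary]
    rfl

theorem forestSeries_of_length_ne_one {cs : List PlaneTree} (h : cs.length ≠ 1) :
    forestSeries cs = gf (innerCount cs) :=
  congrArg gf (funext fun T => forestCount_of_length_ne_one h T)

theorem forestSeries_nil : forestSeries [] = X + X * forestSeries [] ^ 2 := by
  conv_lhs => rw [forestSeries_of_length_ne_one (by simp), gf_innerCount]
  simp [pow_two]

/-- The series `1 - 2XB`, with `B` the generating function of binary trees. -/
noncomputable def rootSeries : ℝ⟦X⟧ := 1 - 2 * X * forestSeries []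

/-- Completing the square in B = X + XB². -/
theorem rootSeries_sq : rootSeries ^ 2 = 1 - 4 * X ^ 2 := by
  have h := forestSeries_nil
  unfold rootSeries
  linear_combination (-4 * X) * h

theorem constantCoeff_rootSeries : constantCoeff rootSeries = 1 := by
  simp [rootSeries]

theorem rootSeries_ne_zero : rootSeries ≠ 0 := by
  intro h
  simpa [h] using constantCoeff_rootSeries

theorem one_sub_rootSeries : 1 - rootSeries = 2 * X * forestSeries [] := by
  simp [rootSeries]

/-- The embeddings that are not good lie wholly in the left or wholly in the right subtree, which
gives 2XB times the series of all embeddings. -/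
theorem gf_numGoodEmbeddings (S : PlaneTree) :
    gf (numGoodEmbeddings S) = rootSeries * forestSeries [S] := by
  have h1 : forestSeries [S] = gf (innerCount [S]) + gf (numGoodEmbeddings S) := by
    ext n
    simp [forestSeries, gf, forestCount_singleton, Finset.sum_add_distrib]
  have h2 := gf_innerCount [S]
  simp [Finset.sum_range_succ] at h2
  unfold rootSeries
  linear_combination -h1 - h2

theorem rootSeries_mul_forestSeries {cs : List PlaneTree} {k : ℕ} (h : cs.length = k + 2) :
    rootSeries * forestSeries cs = X * ∑ i ∈ Finset.range (k + 1),
      forestSeries (cs.take (i + 1)) * forestSeries (cs.drop (i + 1)) := by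
  have h2 := gf_innerCount cs
  have hne : cs ≠ [] := by rintro rfl; simp at h
  rw [← forestSeries_of_length_ne_one (by omega), h, Finset.sum_range_succ, Finset.sum_range_succ',
    ← h, if_neg hne] at h2
  simp only [List.take_zero, List.drop_zero, List.take_length, List.drop_length] at h2
  unfold rootSeries
  linear_combination h2

/-- Each proper cut splits the forest into two shorter nonempty ones, so the constants obey the
recursion `catalan_succ`: they count the ways to separate the trees by successive binary cuts. -/
theorem rootSeries_pow_mul_forestSeries {cs : List PlaneTree} {k : ℕ} (h : cs.length = k + 1) :
    rootSeries ^ k * forestSeries cs =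
      (catalan k : ℝ⟦X⟧) * X ^ k * (cs.map fun S => forestSeries [S]).prod := by
  induction k using Nat.strong_induction_on generalizing cs with
  | _ k ih =>
    cases k with
    | zero =>
      obtain ⟨S, rfl⟩ := List.length_eq_one_iff.1 h
      simp
    | succ k =>
      rw [pow_succ, mul_assoc, rootSeries_mul_forestSeries h, catalan_succ, Nat.cast_sum,
        Fin.sum_univ_eq_sum_range (fun i => ((catalan i * catalan (k - i) : ℕ) : ℝ⟦X⟧)),
        mul_left_comm, Finset.mul_sum, Finset.mul_sum, Finset.sum_mul, Finset.sum_mul]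
      refine Finset.sum_congr rfl fun i hi => ?_
      rw [Finset.mem_range] at hi
      have h1 := ih i hi (cs := cs.take (i + 1)) (by simp; omega)
      have h2 := ih (k - i) (by omega) (cs := cs.drop (i + 1)) (by simp; omega)
      have h3 : (cs.map fun S => forestSeries [S]).prod =
          ((cs.take (i + 1)).map fun S => forestSeries [S]).prod *
          ((cs.drop (i + 1)).map fun S => forestSeries [S]).prod := by
        rw [← List.prod_append, ← List.map_append, List.take_append_drop]
      rw [h3]
      obtain ⟨j, rfl⟩ : ∃ j, k = i + j := ⟨k - i, by omega⟩
      rw [Nat.add_sub_cancel_left] at h2 ⊢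
      calc X * (rootSeries ^ (i + j) * (forestSeries (cs.take (i + 1)) *
            forestSeries (cs.drop (i + 1))))
          = X * ((rootSeries ^ i * forestSeries (cs.take (i + 1))) *
            (rootSeries ^ j * forestSeries (cs.drop (i + 1)))) := by ring
        _ = _ := by rw [h1, h2]; push_cast; ring

/-! ### The closed form and its Catalan constant -/

/-- The product over the internal vertices of `S` of the Catalan numbers whose index is the
out-degree minus one. -/
def catalanProd : PlaneTree → ℕ
  | node d c => catalan (d - 1) * ∏ j, (c j).catalanProd

/-- A leaf brings (1 - R)/(2X) and one division by R, a vertex with one child brings (1 - R)/R, and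
a vertex with d ≥ 2 children brings C_(d-1) X^(d-1)/R^d. The powers of X collapse because the
numbers d - 1 over internal vertices sum to l - 1. The extra R on the right avoids subtraction in
the exponent m + l - 1. -/
theorem forestSeries_singleton (S : PlaneTree) :
    2 ^ S.leaves * X * rootSeries ^ (S.size + S.leaves) * forestSeries [S] =
      rootSeries * ((S.catalanProd : ℝ⟦X⟧) * (1 - rootSeries) ^ (S.leaves + S.degreeCount 1)) := by
  induction S with
  | node d c ih =>
    have hG := gf_numGoodEmbeddings (node d c)
    rw [show numGoodEmbeddings (node d c) = innerCount (List.ofFn c) from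
      funext (numGoodEmbeddings_node c)] at hG
    match d, c, ih, hG with
    | 0, c, ih, hG =>
      rw [List.ofFn_zero, ← forestSeries_of_length_ne_one (by simp)] at hG
      have := one_sub_rootSeries
      simp only [leaves, size, degreeCount, catalanProd]
      simp
      linear_combination (-2 * X * rootSeries) * hG - rootSeries * this
    | 1, c, ih, hG =>
      have h := gf_innerCount [c 0]
      rw [show List.ofFn c = [c 0] by simp] at hG
      simp [Finset.sum_range_succ] at h
      rw [hG] at h
      have := one_sub_rootSeries
      have ih := ih 0
      simp only [leaves] at ih
      simp only [leaves, size, degreeCount, catalanProd, Fin.sum_univ_one, Fin.prod_univ_one]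
      simp
      apply mul_left_cancel₀ rootSeries_ne_zero
      linear_combination (2 ^ degreeCount 0 (c 0) * X *
        rootSeries ^ (1 + (c 0).size + degreeCount 0 (c 0))) *
          (h - forestSeries [c 0] * this) + (1 - rootSeries) * rootSeries * ih
    | k + 2, c, ih, hG =>
      rw [← forestSeries_of_length_ne_one (by simp)] at hG
      have hF := rootSeries_pow_mul_forestSeries (cs := List.ofFn c) (k := k + 1) (by simp)
      rw [hG, List.map_ofFn, List.prod_ofFn] at hF
      have hP := Finset.prod_congr (rfl : Finset.univ = Finset.univ) fun j _ => ih j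
      simp only [Finset.prod_mul_distrib, Finset.prod_pow_eq_pow_sum, Finset.sum_add_distrib,
        Finset.prod_const, Finset.card_univ, Fintype.card_fin] at hP
      simp only [leaves] at hP
      simp only [leaves, size, degreeCount, catalanProd]
      simp
      -- The identities of the `k + 2` children each carry a spare factor `rootSeries` on the right.
      apply mul_left_cancel₀ (pow_ne_zero (k + 2) rootSeries_ne_zero)
      simp only [Function.comp_apply] at hF
      generalize (∏ x, forestSeries [c x]) = P at *
      generalize (∏ x, ((c x).catalanProd : ℝ⟦X⟧)) = Q at *
      generalize (∑ i, degreeCount 0 (c i)) = a at *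
      generalize (∑ i, degreeCount 1 (c i)) = b at *
      generalize (∑ i, (c i).size) = e at *
      linear_combination (2 ^ a * X * rootSeries ^ (1 + e + a)) * hF +
        (catalan (k + 1) : ℝ⟦X⟧) * rootSeries * hP

theorem degreeCount_eq_zero {i : ℕ} {S : PlaneTree} (h : S.size ≤ i) : S.degreeCount i = 0 := by
  induction S with
  | node d c ih =>
    simp only [size] at h
    have hd : d ≤ ∑ j, (c j).size := by
      calc d = ∑ _j : Fin d, 1 := by simp
        _ ≤ _ := Finset.sum_le_sum fun j _ => (c j).size_pos
    simp only [degreeCount]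
    rw [if_neg (by omega), zero_add]
    refine Finset.sum_eq_zero fun j _ => ?_
    have := Finset.single_le_sum (f := fun j => (c j).size) (fun _ _ => Nat.zero_le _)
      (Finset.mem_univ j)
    exact ih j (by omega)

theorem catalanProd_eq_prod {S : PlaneTree} {n : ℕ} (h : S.size ≤ n) :
    S.catalanProd = ∏ i ∈ Finset.range n, catalan (i - 1) ^ S.degreeCount i := by
  induction S with
  | node d c ih =>
    simp only [size] at h
    have hd : d ≤ ∑ j, (c j).size := by
      calc d = ∑ _j : Fin d, 1 := by simp
        _ ≤ _ := Finset.sum_le_sum fun j _ => (c j).size_pos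
    simp only [degreeCount, catalanProd, pow_add, Finset.prod_mul_distrib, pow_ite, pow_one,
      pow_zero, ← Finset.prod_pow_eq_pow_sum]
    rw [Finset.prod_ite_eq, if_pos (by simp; omega), Finset.prod_comm]
    congr 1
    refine Finset.prod_congr rfl fun j _ => ih j ?_
    have := Finset.single_le_sum (f := fun j => (c j).size) (fun _ _ => Nat.zero_le _)
      (Finset.mem_univ j)
    omega

/-- Out-degrees below 3 contribute `catalan 0` or `catalan 1`, both equal to 1; for leaves this uses
`0 - 1 = 0`. -/
theorem catalanFactor_eq (S : PlaneTree) : S.catalanFactor = S.catalanProd := by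
  rw [catalanProd_eq_prod le_rfl, catalanFactor]
  refine Finset.prod_subset (fun i hi => ?_) fun i hi hi' => ?_
  · have := S.size_pos
    simp at hi ⊢; omega
  · have : i < 3 := by simp at hi hi'; omega
    interval_cases i <;> simp

theorem leaves_pos (S : PlaneTree) : 0 < S.leaves := by
  induction S with
  | node d c ih =>
    simp only [leaves, degreeCount] at ih ⊢
    split_ifs with h
    · omega
    · have := Finset.single_le_sum (f := fun j => (c j).degreeCount 0) (fun _ _ => Nat.zero_le _)
        (Finset.mem_univ ⟨0, Nat.pos_of_ne_zero h⟩)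
      have := ih ⟨0, Nat.pos_of_ne_zero h⟩
      omega

theorem catalanFactor_pos (S : PlaneTree) : 0 < S.catalanFactor := by
  refine Finset.prod_pos fun i _ => pow_pos (Nat.pos_of_ne_zero fun h => ?_) _
  have := succ_mul_catalan_eq_centralBinom (i - 1)
  rw [h, mul_zero] at this
  exact (Nat.centralBinom_pos _).ne this

/-! ### Real powers of 1 - 4X² and their coefficients -/

/-- The power series of `(1 - 4 X ^ 2) ^ r`. -/
noncomputable def quadPow (r : ℝ) : ℝ⟦X⟧ :=
  PowerSeries.expand 2 two_ne_zero (rescale (-4) (PowerSeries.binomialSeries ℝ r))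

theorem quadPow_add (r t : ℝ) : quadPow (r + t) = quadPow r * quadPow t := by
  simp [quadPow]

theorem quadPow_zero : quadPow 0 = 1 := by
  simp [quadPow]

theorem quadPow_one : quadPow 1 = 1 - 4 * X ^ 2 := by
  have h : PowerSeries.binomialSeries ℝ (1 : ℝ) = 1 + X := by
    simpa using binomialSeries_nat (R := ℝ) (A := ℝ) 1
  rw [quadPow, h, map_add, map_add, map_one, map_one, rescale_X, map_mul, expand_X, expand_C]
  rw [map_neg, map_ofNat]
  ring

theorem quadPow_pow (r : ℝ) (k : ℕ) : quadPow r ^ k = quadPow (k * r) := by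
  induction k with
  | zero => simp [quadPow_zero]
  | succ k ih => rw [pow_succ, ih, ← quadPow_add]; push_cast; ring_nf

/-- Both sides square to 1 - 4X², so they agree up to sign, and the constant terms fix the sign. -/
theorem rootSeries_eq : rootSeries = quadPow (1 / 2) := by
  have h : (rootSeries - quadPow (1 / 2)) * (rootSeries + quadPow (1 / 2)) = 0 := by
    have h1 : quadPow (1 / 2) ^ 2 = 1 - 4 * X ^ 2 := by
      rw [quadPow_pow, ← quadPow_one]; norm_num
    linear_combination rootSeries_sq - h1
  rcases mul_eq_zero.1 h with h | h
  · exact sub_eq_zero.1 h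
  · have := congrArg constantCoeff h
    rw [map_add, constantCoeff_rootSeries, quadPow, constantCoeff_expand] at this
    rw [← coeff_zero_eq_constantCoeff_apply, coeff_rescale] at this
    norm_num at this

theorem coeff_quadPow_neg (r : ℝ) (n : ℕ) :
    coeff (2 * n) (quadPow (-r)) = 4 ^ n * Ring.multichoose r n := by
  rw [quadPow, coeff_expand_mul, coeff_rescale, binomialSeries_coeff, Ring.choose_neg']
  simp only [Int.negOnePow, Units.smul_def, smul_eq_mul, mul_one, zsmul_eq_mul]
  rw [← mul_assoc]
  congr 1
  simp
  rw [← mul_pow]; norm_num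

/-- Divide by R^p and expand (1 - R)^k binomially: the j-th term is a multiple of (1 -
4X²)^(-(p-j)/2). -/
theorem coeff_of_mul_rootSeries_pow {F : ℝ⟦X⟧} {a K : ℝ} {p k : ℕ}
    (h : C a * X * rootSeries ^ p * F = C K * (1 - rootSeries) ^ k) (n : ℕ) :
    a * coeff (2 * n + 1) F = K * ∑ j ∈ Finset.range (k + 1),
      (-1) ^ j * (k.choose j : ℝ) * (4 ^ (n + 1) * Ring.multichoose (((p : ℝ) - j) / 2) (n + 1)) := by
  have h1 : C a * (X * F) = C K * ∑ j ∈ Finset.range (k + 1),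
      C ((-1) ^ j * (k.choose j : ℝ)) * quadPow (-(((p : ℝ) - j) / 2)) := by
    have h2 : rootSeries ^ p * quadPow (-(p / 2 : ℝ)) = 1 := by
      rw [rootSeries_eq, quadPow_pow, ← quadPow_add, ← quadPow_zero]; congr 1; ring
    calc C a * (X * F) = (C a * X * rootSeries ^ p * F) * quadPow (-(p / 2 : ℝ)) := by
          linear_combination (-(C a * X * F)) * h2
      _ = C K * ((-rootSeries + 1) ^ k * quadPow (-(p / 2 : ℝ))) := by rw [h]; ring
      _ = _ := by
        rw [add_pow, Finset.sum_mul]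
        congr 1
        refine Finset.sum_congr rfl fun j _ => ?_
        rw [show (-(((p : ℝ) - j) / 2)) = j * (1 / 2) + -(p / 2 : ℝ) by ring, quadPow_add,
          ← quadPow_pow, ← rootSeries_eq, neg_pow]
        simp only [map_mul, map_pow, map_neg, map_one, map_natCast]
        ring
  have h3 := congrArg (coeff (2 * (n + 1))) h1
  rw [coeff_C_mul, show 2 * (n + 1) = (2 * n + 1) + 1 by ring, coeff_succ_X_mul, coeff_C_mul,
    map_sum] at h3
  rw [h3]
  congr 1
  refine Finset.sum_congr rfl fun j _ => ?_
  rw [coeff_C_mul, show (2 * n + 1) + 1 = 2 * (n + 1) by ring, coeff_quadPow_neg]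

/-! ### Asymptotics of the coefficients -/

theorem factorial_mul_multichoose (r : ℝ) (n : ℕ) :
    (n.factorial : ℝ) * Ring.multichoose r n = ∏ j ∈ Finset.range n, (r + j) := by
  have := Ring.factorial_nsmul_multichoose_eq_ascPochhammer r n
  rw [nsmul_eq_mul] at this
  rw [this]
  clear this
  induction n with
  | zero => simp
  | succ n ih =>
    rw [Finset.prod_range_succ, ← ih, ascPochhammer_succ_right]
    simp [Polynomial.smeval_mul, Polynomial.smeval_add, Polynomial.smeval_natCast]

/-- This is Euler's limit formula for Γ. At its poles the sequence is eventually zero, and the limit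
is still right because `Real.Gamma` takes the value 0 there and `0⁻¹ = 0`. -/
theorem tendsto_multichoose (r : ℝ) :
    Tendsto (fun n : ℕ => Ring.multichoose r n / (n : ℝ) ^ (r - 1)) atTop
      (nhds (Real.Gamma r)⁻¹) := by
  by_cases hr : ∃ m : ℕ, r = -m
  · obtain ⟨m, rfl⟩ := hr
    rw [Real.Gamma_neg_nat_eq_zero, inv_zero]
    refine tendsto_const_nhds.congr' ?_
    filter_upwards [eventually_gt_atTop m] with n hn
    have h := factorial_mul_multichoose (-m : ℝ) n
    rw [Finset.prod_eq_zero (Finset.mem_range.2 hn) (by simp)] at h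
    rcases mul_eq_zero.1 h with h | h
    · exact absurd h (by exact_mod_cast n.factorial_ne_zero)
    · simp [h]
  · push Not at hr
    have hG : Real.Gamma r ≠ 0 := Real.Gamma_ne_zero hr
    have h1 := (Real.GammaSeq_tendsto_Gamma r).inv₀ hG
    -- The denominator of `Real.GammaSeq` has `n + 1` factors, one more than the rising factorial;
    -- this ratio absorbs the last.
    have h2 : Tendsto (fun n : ℕ => (n : ℝ) / (n + r)) atTop (nhds 1) :=
      tendsto_natCast_div_add_atTop r
    have h3 := h1.mul h2
    rw [mul_one] at h3
    refine h3.congr' ?_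
    filter_upwards [eventually_gt_atTop 0] with n hn
    have hn' : (0 : ℝ) < n := by exact_mod_cast hn
    have hne : ∀ j : ℕ, r + j ≠ 0 := fun j h => hr j (by linarith)
    have hfac : (n.factorial : ℝ) ≠ 0 := by exact_mod_cast n.factorial_ne_zero
    have hpow : (n : ℝ) ^ r ≠ 0 := (Real.rpow_pos_of_pos hn' r).ne'
    have hm := factorial_mul_multichoose r n
    have hne' := hne n
    rw [Real.GammaSeq, Finset.prod_range_succ, ← hm, Real.rpow_sub hn', Real.rpow_one,
      add_comm (n : ℝ) r]
    field_simp

theorem tendsto_multichoose_div {r t : ℝ} (h : r < t) :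
    Tendsto (fun n : ℕ => Ring.multichoose r n / (n : ℝ) ^ (t - 1)) atTop (nhds 0) := by
  have h1 : Tendsto (fun n : ℕ => (n : ℝ) ^ (-(t - r))) atTop (nhds 0) :=
    (tendsto_rpow_neg_atTop (sub_pos.2 h)).comp tendsto_natCast_atTop_atTop
  have h2 := (tendsto_multichoose r).mul h1
  rw [mul_zero] at h2
  refine h2.congr' ?_
  filter_upwards [eventually_gt_atTop 0] with n hn
  have hn' : (0 : ℝ) < n := by exact_mod_cast hn
  rw [div_mul_eq_mul_div, div_eq_div_iff (Real.rpow_pos_of_pos hn' _).ne'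
    (Real.rpow_pos_of_pos hn' _).ne', mul_assoc, ← Real.rpow_add hn']
  congr 2
  ring

theorem tendsto_odd {α : Type*} {g : ℕ → α} {l : Filter α}
    (h : Tendsto (fun n => g (2 * n + 1)) atTop l) : Tendsto g (atTop ⊓ 𝓟 {n : ℕ | Odd n}) l := by
  have h1 : Tendsto (fun n : ℕ => n / 2) (atTop ⊓ 𝓟 {n : ℕ | Odd n}) atTop :=
    (Nat.tendsto_div_const_atTop two_ne_zero).mono_left inf_le_left
  refine (h.comp h1).congr' ?_
  filter_upwards [mem_inf_of_right (mem_principal_self _)] with n hn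
  have hn : Odd n := hn
  simp [Nat.two_mul_div_two_add_one_of_odd hn]

/-- For N = 2n + 1, 4^(n+1) = 2·2^N and n + 1 ~ N/2, whence the factor 2^(1-γ). -/
theorem isEquivalent_odd {f : ℕ → ℝ} {c γ : ℝ} (hc : c ≠ 0)
    (h : Tendsto (fun n : ℕ => f (2 * n + 1) / (4 ^ (n + 1) * ((n + 1 : ℕ) : ℝ) ^ γ)) atTop
      (nhds c)) :
    f ~[atTop ⊓ 𝓟 {n : ℕ | Odd n}] fun n => c * 2 ^ (1 - γ) * 2 ^ n * (n : ℝ) ^ γ := by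
  have hne : ∀ n : ℕ, 0 < n → c * 2 ^ (1 - γ) * 2 ^ n * (n : ℝ) ^ γ ≠ 0 := by
    intro n hn
    have : (0 : ℝ) < n := by exact_mod_cast hn
    have := Real.rpow_pos_of_pos this γ
    positivity
  rw [isEquivalent_iff_tendsto_one]
  · apply tendsto_odd
    have h1 : Tendsto (fun n : ℕ => ((2 * n + 2 : ℝ) / (2 * n + 1))) atTop (nhds 1) := by
      have : Tendsto (fun n : ℕ => 1 + 1 / (2 * (n : ℝ) + 1)) atTop (nhds (1 + 0)) := by
        refine tendsto_const_nhds.add (tendsto_const_nhds.div_atTop ?_)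
        exact tendsto_atTop_add_const_right _ _
          (tendsto_natCast_atTop_atTop.const_mul_atTop two_pos)
      rw [add_zero] at this
      refine this.congr fun n => ?_
      have : (2 * (n : ℝ) + 1) ≠ 0 := by positivity
      field_simp
      ring
    have h2 := h1.rpow_const (p := γ) (Or.inl one_ne_zero)
    rw [Real.one_rpow] at h2
    have h3 := (h.div_const c).mul h2
    rw [div_self hc, mul_one] at h3
    refine h3.congr fun n => ?_
    have e1 : (0 : ℝ) < 2 * n + 1 := by positivity
    have e2 : (0 : ℝ) < n + 1 := by positivity
    have p1 := Real.rpow_pos_of_pos e1 γ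
    have p2 := Real.rpow_pos_of_pos e2 γ
    have p3 := Real.rpow_pos_of_pos (two_pos : (0 : ℝ) < 2) γ
    simp only [Pi.div_apply]
    rw [Real.div_rpow (by positivity) e1.le, show (2 * n + 2 : ℝ) = 2 * (n + 1) by ring,
      Real.mul_rpow two_pos.le e2.le, Real.rpow_sub two_pos, Real.rpow_one]
    push_cast
    rw [show (2 : ℝ) ^ (2 * n + 1) = 4 ^ n * 2 by rw [pow_succ, pow_mul]; norm_num]
    field_simp
    ring
  · filter_upwards [mem_inf_of_left (eventually_gt_atTop 0)] with n hn
    exact hne n hn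

/-- Only the term j = 0 survives; the others have smaller exponent and vanish by
`tendsto_multichoose_div`. -/
theorem tendsto_coeff {F : ℝ⟦X⟧} {a K : ℝ} {p k : ℕ} (ha : a ≠ 0)
    (h : C a * X * rootSeries ^ p * F = C K * (1 - rootSeries) ^ k) :
    Tendsto (fun n : ℕ => coeff (2 * n + 1) F / (4 ^ (n + 1) *
      ((n + 1 : ℕ) : ℝ) ^ ((p : ℝ) / 2 - 1))) atTop (nhds (K / a / Real.Gamma ((p : ℝ) / 2))) := by
  have h1 : Tendsto (fun n : ℕ => K / a * ∑ j ∈ Finset.range (k + 1),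
      (-1) ^ j * (k.choose j : ℝ) * (Ring.multichoose (((p : ℝ) - j) / 2) n /
        (n : ℝ) ^ ((p : ℝ) / 2 - 1))) atTop (nhds (K / a * ∑ j ∈ Finset.range (k + 1),
      (-1) ^ j * (k.choose j : ℝ) * if j = 0 then (Real.Gamma ((p : ℝ) / 2))⁻¹ else 0)) := by
    refine (tendsto_finsetSum _ fun j _ => Tendsto.const_mul _ ?_).const_mul _
    split_ifs with hj
    · subst hj
      simpa using tendsto_multichoose ((p : ℝ) / 2)
    · refine tendsto_multichoose_div ?_
      have : (0 : ℝ) < j := by exact_mod_cast Nat.pos_of_ne_zero hj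
      linarith
  simp only [mul_ite, mul_zero, Finset.sum_ite_eq', Finset.mem_range, Nat.succ_pos, if_true,
    pow_zero, Nat.choose_zero_right, Nat.cast_one, one_mul] at h1
  rw [← div_eq_mul_inv] at h1
  refine (h1.comp (tendsto_add_atTop_nat 1)).congr fun n => ?_
  have h2 := coeff_of_mul_rootSeries_pow h n
  rw [← mul_right_inj' ha, ← mul_div_assoc, h2]
  simp only [Function.comp_apply, Finset.mul_sum, Finset.sum_div]
  refine Finset.sum_congr rfl fun j _ => ?_
  field_simp

theorem isEquivalent_coeff {F : ℝ⟦X⟧} {K : ℝ} {l p k : ℕ} (hK : K ≠ 0) (hp : 0 < p)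
    (h : 2 ^ l * X * rootSeries ^ p * F = C K * (1 - rootSeries) ^ k) :
    (fun n => coeff n F) ~[atTop ⊓ 𝓟 {n : ℕ | Odd n}] fun n : ℕ =>
      K * (2 : ℝ) ^ ((4 - (p : ℝ) - 2 * l) / 2) / Real.Gamma ((p : ℝ) / 2) * 2 ^ n *
        (n : ℝ) ^ ((p : ℝ) / 2 - 1) := by
  have hΓ : 0 < Real.Gamma ((p : ℝ) / 2) := Real.Gamma_pos_of_pos (by positivity)
  have h' : C ((2 : ℝ) ^ l) * X * rootSeries ^ p * F = C K * (1 - rootSeries) ^ k := by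
    rw [map_pow, map_ofNat]
    exact h
  have h1 := isEquivalent_odd (f := fun n => coeff n F) (c := K / 2 ^ l / Real.Gamma ((p : ℝ) / 2)) (by positivity)
    (tendsto_coeff (by positivity) h')
  convert h1 using 4 with n
  rw [show (4 - (p : ℝ) - 2 * l) / 2 = (1 - ((p : ℝ) / 2 - 1)) - (l : ℕ) by ring,
    Real.rpow_sub two_pos, Real.rpow_natCast]
  field_simp

/-! ### From series to embedding counts -/

theorem coeff_forestSeries_singleton (S : PlaneTree) (n : ℕ) :
    coeff n (forestSeries [S]) = S.totalEmbeddings n := by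
  simp [forestSeries, gf, totalEmbeddings, numEmbeddings_eq]

theorem coeff_gf_numGoodEmbeddings (S : PlaneTree) (n : ℕ) :
    coeff n (gf (numGoodEmbeddings S)) = S.totalGoodEmbeddings n := by
  simp [gf, totalGoodEmbeddings]

theorem goodSeries_eq (S : PlaneTree) {q : ℕ} (hq : S.size + S.leaves = q + 2) :
    2 ^ S.leaves * X * rootSeries ^ q * gf (numGoodEmbeddings S) =
      C (S.catalanFactor : ℝ) * (1 - rootSeries) ^ (S.leaves + S.degreeCount 1) := by
  have h := forestSeries_singleton S
  apply mul_left_cancel₀ rootSeries_ne_zero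
  rw [hq] at h
  rw [gf_numGoodEmbeddings, catalanFactor_eq, map_natCast, ← h]
  ring

theorem embeddingSeries_eq (S : PlaneTree) {p : ℕ} (hp : S.size + S.leaves = p + 1) :
    2 ^ S.leaves * X * rootSeries ^ p * forestSeries [S] =
      C (S.catalanFactor : ℝ) * (1 - rootSeries) ^ (S.leaves + S.degreeCount 1) := by
  have h := forestSeries_singleton S
  apply mul_left_cancel₀ rootSeries_ne_zero
  rw [hp] at h
  rw [catalanFactor_eq, map_natCast, ← h]
  ring

/-- Here 2XG = 1 - R, so the growth is that of the coefficients of -(1 - 4X²)^(1/2), governed by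
Γ(-1/2) = -2√π. -/
theorem isEquivalent_good_of_single {S : PlaneTree} (h : S.size + S.leaves = 2) :
    (fun n : ℕ => (S.totalGoodEmbeddings n : ℝ)) ~[atTop ⊓ 𝓟 {n : ℕ | Odd n}]
      (fun n : ℕ => Real.sqrt 2 * (2 : ℝ) ^ n / Real.sqrt (Real.pi * (n : ℝ) ^ 3)) := by
  have hs : S.size = 1 := by have := S.size_pos; have := S.leaves_pos; omega
  have hl : S.leaves = 1 := by omega
  have hd : S.degreeCount 1 = 0 := degreeCount_eq_zero hs.le
  have hC : S.catalanFactor = 1 := by simp [catalanFactor, hs]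
  have hF := goodSeries_eq S (q := 0) h
  rw [hl, hd, hC] at hF
  have hΓ : Real.Gamma (-1 / 2) = -(2 * Real.sqrt Real.pi) := by
    have h1 := Real.Gamma_add_one (s := -1 / 2) (by norm_num)
    rw [show (-1 / 2 + 1 : ℝ) = 1 / 2 by norm_num, Real.Gamma_one_half_eq] at h1
    linarith
  have hπ : 0 < Real.sqrt Real.pi := Real.sqrt_pos.2 Real.pi_pos
  have ht : Tendsto (fun n : ℕ => (S.totalGoodEmbeddings (2 * n + 1) : ℝ) /
      (4 ^ (n + 1) * ((n + 1 : ℕ) : ℝ) ^ (-3 / 2 : ℝ))) atTop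
      (nhds (1 / (4 * Real.sqrt Real.pi))) := by
    have h1 := ((tendsto_multichoose (-1 / 2)).comp (tendsto_add_atTop_nat 1)).const_mul (-1 / 2)
    rw [hΓ] at h1
    have h2 : -1 / 2 * (-(2 * Real.sqrt Real.pi))⁻¹ = 1 / (4 * Real.sqrt Real.pi) := by
      field_simp
      norm_num
    rw [h2] at h1
    refine h1.congr fun n => ?_
    have hF' : C (2 : ℝ) * X * rootSeries ^ 0 * gf (numGoodEmbeddings S) =
        C (1 : ℝ) * (1 - rootSeries) ^ 1 := by
      rw [map_ofNat]
      simpa using hF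
    have h3 := coeff_of_mul_rootSeries_pow hF' n
    rw [coeff_gf_numGoodEmbeddings, Finset.sum_range_succ, Finset.sum_range_one] at h3
    have h4 : Ring.multichoose (((0 : ℕ) - (0 : ℕ) : ℝ) / 2) (n + 1) = 0 := by
      simp [Ring.multichoose_zero_succ]
    have h5 : (((0 : ℕ) - (1 : ℕ) : ℝ) / 2) = -1 / 2 := by norm_num
    rw [h4, h5] at h3
    have h6 : (S.totalGoodEmbeddings (2 * n + 1) : ℝ) =
        -1 / 2 * (4 ^ (n + 1) * Ring.multichoose (-1 / 2 : ℝ) (n + 1)) := by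
      norm_num at h3
      linarith
    rw [h6, Function.comp_apply, show (-1 / 2 - 1 : ℝ) = -3 / 2 by norm_num]
    field_simp
  convert isEquivalent_odd (f := fun n => (S.totalGoodEmbeddings n : ℝ)) (by positivity) ht
    using 2 with n
  have hn : Real.sqrt ((n : ℝ) ^ 3) = (n : ℝ) ^ (3 / 2 : ℝ) := by
    rw [Real.sqrt_eq_rpow, ← Real.rpow_natCast, ← Real.rpow_mul n.cast_nonneg]
    norm_num
  have h2 : (2 : ℝ) ^ (1 - -3 / 2 : ℝ) = 4 * Real.sqrt 2 := by
    rw [show (1 - -3 / 2 : ℝ) = (2 : ℕ) + 1 / 2 by norm_num, Real.rpow_add two_pos,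
      Real.rpow_natCast, ← Real.sqrt_eq_rpow]
    norm_num
  rw [Real.sqrt_mul Real.pi_pos.le, hn, h2, show (-3 / 2 : ℝ) = -(3 / 2) by norm_num,
    Real.rpow_neg n.cast_nonneg]
  field_simp

end PlaneTree

theorem mainTheorem1 (S : PlaneTree) (m l : ℕ) (hm : m = S.size) (hl : l = S.leaves) :
    ((fun n : ℕ => (S.totalEmbeddings n : ℝ)) ~[atTop ⊓ 𝓟 {n : ℕ | Odd n}]
      (fun n : ℕ => (S.catalanFactor : ℝ) * (2 : ℝ) ^ ((5 - (m : ℝ) - 3 * (l : ℝ)) / 2) /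
        Real.Gamma (((m : ℝ) + (l : ℝ) - 1) / 2) * (2 : ℝ) ^ n *
          (n : ℝ) ^ (((m : ℝ) + (l : ℝ) - 3) / 2))) ∧
    (∀ n : ℕ, Even n → S.totalEmbeddings n = 0) ∧
    (2 < m + l →
      (fun n : ℕ => (S.totalGoodEmbeddings n : ℝ)) ~[atTop ⊓ 𝓟 {n : ℕ | Odd n}]
        (fun n : ℕ => (S.catalanFactor : ℝ) * (2 : ℝ) ^ ((6 - (m : ℝ) - 3 * (l : ℝ)) / 2) /
          Real.Gamma (((m : ℝ) + (l : ℝ) - 2) / 2) * (2 : ℝ) ^ n *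
            (n : ℝ) ^ (((m : ℝ) + (l : ℝ) - 4) / 2))) ∧
    (m + l = 2 →
      (fun n : ℕ => (S.totalGoodEmbeddings n : ℝ)) ~[atTop ⊓ 𝓟 {n : ℕ | Odd n}]
        (fun n : ℕ => Real.sqrt 2 * (2 : ℝ) ^ n / Real.sqrt (Real.pi * (n : ℝ) ^ 3))) ∧
    (∀ n : ℕ, Even n → S.totalGoodEmbeddings n = 0) := by
  subst hm hl
  have hC : (S.catalanFactor : ℝ) ≠ 0 := by exact_mod_cast S.catalanFactor_pos.ne'
  have hs := S.size_pos
  have hl := S.leaves_pos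
  refine ⟨?_, fun n hn => by simp [PlaneTree.totalEmbeddings, PlaneTree.binaryTrees_of_even hn], fun h => ?_,
    PlaneTree.isEquivalent_good_of_single, fun n hn => by simp [PlaneTree.totalGoodEmbeddings, PlaneTree.binaryTrees_of_even hn]⟩
  · obtain ⟨p, hp⟩ : ∃ p, S.size + S.leaves = p + 1 := ⟨S.size + S.leaves - 1, by omega⟩
    have key := PlaneTree.isEquivalent_coeff hC (by omega) (PlaneTree.embeddingSeries_eq S hp)
    simp only [PlaneTree.coeff_forestSeries_singleton] at key
    have hp' : (S.size : ℝ) = p + 1 - S.leaves := by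
      have : (S.size : ℝ) + S.leaves = p + 1 := by exact_mod_cast hp
      linarith
    rw [hp']
    convert key using 8 <;> ring
  · obtain ⟨q, hq⟩ : ∃ q, S.size + S.leaves = q + 2 := ⟨S.size + S.leaves - 2, by omega⟩
    have key := PlaneTree.isEquivalent_coeff hC (by omega) (PlaneTree.goodSeries_eq S hq)
    simp only [PlaneTree.coeff_gf_numGoodEmbeddings] at key
    have hq' : (S.size : ℝ) = q + 2 - S.leaves := by
      have : (S.size : ℝ) + S.leaves = q + 2 := by exact_mod_cast hq
      linarith
    rw [hq']
    convert key using 8 <;> ring
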